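/- **Setting.** A qubit state is a positive semidefinite $2\times2$ complex matrix of trace $1$. For states put $F(\rho,\sigma)=\|\sqrt\rho\sqrt\sigma\|_1$, where $\|A\|_1=\operatorname{tr}\sqrt{A^\dagger A}$ (square-root Uhlmann fidelity). Let $\mathcal D_1,\mathcal D_2$ be compact sets of qubit states, finite or infinite, and $F_{\max}=\sup_{\rho_1\in\mathcal D_1,\rho_2\in\mathcal D_2}F(\rho_1,\rho_2)$. For $p\in(0,1)$ and $n\ge1$ let $$P_{e,\min}(n)=\inf_{0\le\Pi\le I}\ \sup_{\rho_1\in\mathcal D_1,\,\rho_2\in\mathcal D_2}\Bigl(p\operatorname{tr}\bigl((I-\Pi)\rho_1^{\otimes n}\bigr)+(1-p)\operatorname{tr}\bigl(\Pi\rho_2^{\otimes n}\bigr)\Bigr),$$ the infimum being over operators $\Pi$ on $(\mathbb C^2)^{\otimes n}$. For $\delta\in(0,1)$ let $n^*(\delta)=\inf\{n\ge1: P_{e,\min}(n)\le\delta\}$ be the sample complexity. **Theorem.** Let $p\in(0,1)$. Consider all pairs of compact sets $\mathcal D_1,\mathcal D_2$ of qubit states with $F_{\max}\le\frac25$ that are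 not orthogonal (there are $\rho_1\in\mathcal D_1$, $\rho_2\in\mathcal D_2$ with $\rho_1\rho_2\ne0$), and all $\delta$ with $0<\delta<\min\{p,1-p\}$. 1. $n^*(\delta)$ is finite, the infimum below is a finite real number, and $$n^*(\delta)\le\left\lceil\inf_{a\in(0,\ln(5/2))}\frac{\ln\frac{\sqrt{p(1-p)}}{\delta}+\ln\frac{9e^{3(a-1)}}{2a^3}}{-\ln F_{\max}-a}\right\rceil .$$ 2. $n^*(\delta)=\Theta\bigl(\frac{\ln(1/\delta)}{-\ln F_{\max}}\bigr)$ for fixed $p$, in the following sense. There are constants $c,C>0$ depending only on $p$ such that, for all such $\mathcal D_1,\mathcal D_2,\delta$, $$c\,\frac{\ln(1/\delta)}{-\ln F_{\max}}\le n^*(\delta)\le C\max\Bigl\{1,\frac{\ln(1/\delta)}{-\ln F_{\max}}\Bigr\},$$ and moreover $n^*(\delta)\le C\,\frac{\ln(1/\delta)}{-\ln F_{\max}}$ whenever $\delta\le F_{\max}$. -/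

import Mathlib

open scoped MatrixOrder ComplexOrder

noncomputable section

namespace CompositeQHT

/-- Density matrices on a finite-dimensional Hilbert space with orthonormal basis `ι`. -/
def IsState {ι : Type*} [Fintype ι] (ρ : Matrix ι ι ℂ) : Prop :=
  ρ.PosSemidef ∧ ρ.trace = 1

/-- The trace norm `‖A‖₁ = tr √(A† A)`. -/
def traceNorm {ι : Type*} [Fintype ι] [DecidableEq ι] (A : Matrix ι ι ℂ) : ℝ :=
  (CFC.sqrt (A.conjTranspose * A)).trace.re

/-- The (square root) Uhlmann fidelity `F(ρ, σ) = ‖√ρ √σ‖₁`. -/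
def fidelity {ι : Type*} [Fintype ι] [DecidableEq ι] (ρ σ : Matrix ι ι ℂ) : ℝ :=
  traceNorm (CFC.sqrt ρ * CFC.sqrt σ)

/-- The tensor power `ρ^{⊗ n}`, written in the product basis of `(ℂ^d)^{⊗ n}`, which is indexed
by the words of length `n` over the basis of `ℂ^d`. -/
def tensorPow {d : ℕ} (ρ : Matrix (Fin d) (Fin d) ℂ) (n : ℕ) :
    Matrix (Fin n → Fin d) (Fin n → Fin d) ℂ :=
  Matrix.of fun f g => ∏ i, ρ (f i) (g i)

/-- The operators `Π` with `0 ≤ Π ≤ I`, i.e. the two-outcome measurements `{Π, I - Π}`. -/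
def IsTest {ι : Type*} [Fintype ι] [DecidableEq ι] (T : Matrix ι ι ℂ) : Prop :=
  T.PosSemidef ∧ (1 - T).PosSemidef

/-- The expected error probability `p tr((I - Π) σ₁) + (1 - p) tr(Π σ₂)`. -/
def errorProb {ι : Type*} [Fintype ι] [DecidableEq ι] (T : Matrix ι ι ℂ) (p : ℝ)
    (σ₁ σ₂ : Matrix ι ι ℂ) : ℝ :=
  p * ((1 - T) * σ₁).trace.re + (1 - p) * (T * σ₂).trace.re

/-- The worst-case expected error probability of the test `Π` on `n` copies: the supremum over
`ρ₁ ∈ D₁`, `ρ₂ ∈ D₂` of the error probability on `ρ₁^{⊗ n}`, `ρ₂^{⊗ n}`. -/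
def compositeErrorProb {d : ℕ} (n : ℕ) (T : Matrix (Fin n → Fin d) (Fin n → Fin d) ℂ) (p : ℝ)
    (D₁ D₂ : Set (Matrix (Fin d) (Fin d) ℂ)) : ℝ :=
  sSup {e : ℝ | ∃ ρ₁ ∈ D₁, ∃ ρ₂ ∈ D₂, e = errorProb T p (tensorPow ρ₁ n) (tensorPow ρ₂ n)}

/-- The min-max expected error probability on `n` copies. -/
def minErrorProb {d : ℕ} (n : ℕ) (p : ℝ) (D₁ D₂ : Set (Matrix (Fin d) (Fin d) ℂ)) : ℝ :=
  sInf {e : ℝ | ∃ T : Matrix (Fin n → Fin d) (Fin n → Fin d) ℂ,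
    IsTest T ∧ e = compositeErrorProb n T p D₁ D₂}

/-- The sample complexity `n*(p, D₁, D₂, δ)`: the least number `n ≥ 1` of copies with min-max
expected error probability at most `δ`, and `⊤` if there is none. -/
def sampleComplexity {d : ℕ} (p : ℝ) (D₁ D₂ : Set (Matrix (Fin d) (Fin d) ℂ)) (δ : ℝ) : ℕ∞ :=
  ⨅ (n : ℕ) (_ : 1 ≤ n ∧ minErrorProb n p D₁ D₂ ≤ δ), (n : ℕ∞)

/-- The maximal fidelity `F_max` between states of `D₁` and states of `D₂`. -/
def maxFidelity {d : ℕ} (D₁ D₂ : Set (Matrix (Fin d) (Fin d) ℂ)) : ℝ :=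
  sSup {f : ℝ | ∃ ρ₁ ∈ D₁, ∃ ρ₂ ∈ D₂, f = fidelity ρ₁ ρ₂}

/-- Pairs of compact sets of qubit states that are not orthogonal to each other (in particular
both are nonempty) and that satisfy the max-fidelity constraint `F_max ≤ 2/5`. -/
structure IsConstrainedPair (D₁ D₂ : Set (Matrix (Fin 2) (Fin 2) ℂ)) : Prop where
  isCompact_left : IsCompact D₁
  isCompact_right : IsCompact D₂
  isState_left : ∀ ρ ∈ D₁, IsState ρ
  isState_right : ∀ ρ ∈ D₂, IsState ρ
  not_orthogonal : ∃ ρ₁ ∈ D₁, ∃ ρ₂ ∈ D₂, ρ₁ * ρ₂ ≠ 0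
  maxFidelity_le : maxFidelity D₁ D₂ ≤ 2 / 5

end CompositeQHT

end

/-! The upper bound on the error comes from a minimax reduction. Tests form a compact convex set and
the error is affine in the test and in the pair of states, so by Sion one test works for all pairs
as soon as every pair of mixtures of `n`-fold powers has its own good test
(`exists_isTest_forall_errorProb_le`). Powers of Hermitian `2 × 2` matrices span a real space of
dimension at most `K = (n+3).choose 3`, so by Carathéodory each mixture needs at most `K` terms
(`exists_mixture_of_mem_convexHull`).

For two such mixtures, Powers–Størmer bounds the error by `tr (√A √B)`, with the priors absorbed in
`A` and `B`. This trace splits into pairwise fidelities (`re_trace_sqrt_mul_sqrt_le`), and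
Cauchy–Schwarz on the weights gives `√(p(1-p)) K F_max ^ n`. The cubic `K` is at most a constant
times `exp (a n)`, and solving for `n` gives the explicit bound.

Conversely, every test errs by at least `p(1-p) F²` on a pair of fidelity `F`, and fidelity is
multiplicative under tensor powers. This gives the matching lower bound. The gap `-log F_max ≥ log
(5/2)` turns additive constants into multiplicative ones. -/

namespace CompositeQHT

/-! ### Trace inequalities, contractions and the trace norm -/

section Matrix

variable {ι : Type*} [Fintype ι]

lemma re_trace_mul_comm (A B : Matrix ι ι ℂ) : (A * B).trace.re = (B * A).trace.re := by
  rw [Matrix.trace_mul_comm]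

lemma re_trace_conjTranspose (A : Matrix ι ι ℂ) : A.conjTranspose.trace.re = A.trace.re := by
  rw [Matrix.trace_conjTranspose]; simp

lemma re_trace_nonneg {A : Matrix ι ι ℂ} (hA : A.PosSemidef) : 0 ≤ A.trace.re :=
  (Complex.le_def.mp hA.trace_nonneg).1

variable [DecidableEq ι]

lemma sqrt_mul_sqrt {A : Matrix ι ι ℂ} (hA : A.PosSemidef) : CFC.sqrt A * CFC.sqrt A = A :=
  CFC.sqrt_mul_sqrt_self A hA.nonneg

lemma posSemidef_sqrt (A : Matrix ι ι ℂ) : (CFC.sqrt A).PosSemidef :=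
  Matrix.nonneg_iff_posSemidef.mp (CFC.sqrt_nonneg A)

lemma re_trace_mul_nonneg {A B : Matrix ι ι ℂ} (hA : A.PosSemidef) (hB : B.PosSemidef) :
    0 ≤ (A * B).trace.re := by
  have h := re_trace_nonneg (hA.mul_mul_conjTranspose_same (CFC.sqrt B))
  rwa [(posSemidef_sqrt B).1.eq, Matrix.mul_assoc, re_trace_mul_comm, Matrix.mul_assoc,
    sqrt_mul_sqrt hB] at h

lemma continuousOn_spectrum (A : Matrix ι ι ℂ) (f : ℝ → ℝ) : ContinuousOn f (spectrum ℝ A) :=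
  A.finite_real_spectrum.continuousOn f

lemma cfc_mul' (A : Matrix ι ι ℂ) (f g : ℝ → ℝ) :
    cfc f A * cfc g A = cfc (fun x => f x * g x) A :=
  (cfc_mul f g A (continuousOn_spectrum A f) (continuousOn_spectrum A g)).symm

lemma posSemidef_cfc (A : Matrix ι ι ℂ) {f : ℝ → ℝ} (hf : ∀ x, 0 ≤ f x) : (cfc f A).PosSemidef :=
  Matrix.nonneg_iff_posSemidef.mp (cfc_nonneg fun x _ => hf x)

/-- The Powers–Størmer inequality: a projective test whose total error is at most `tr (X Y)`. -/
lemma exists_isTest_le_trace_mul {X Y : Matrix ι ι ℂ} (hX : X.PosSemidef) (hY : Y.PosSemidef) :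
    ∃ T, IsTest T ∧
      ((1 - T) * (X * X)).trace.re + (T * (Y * Y)).trace.re ≤ (X * Y).trace.re := by
  set D := X - Y with hD
  have hDs : IsSelfAdjoint D := hX.1.isSelfAdjoint.sub hY.1.isSelfAdjoint
  -- `Q` projects onto the nonpositive part of `D = X - Y`, and `D = P - N` is the Jordan
  -- decomposition. With the test `1 - Q`, the right side minus the left is `tr (P Y) + tr (N X) ≥
  -- 0`.
  set Q := cfc (fun x : ℝ => if 0 < x then (0 : ℝ) else 1) D with hQ
  set N := cfc (fun x : ℝ => max (-x) 0) D with hN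
  set P := cfc (fun x : ℝ => max x 0) D with hP
  have hDid : D = cfc (fun x : ℝ => x) D := (cfc_id' ℝ D).symm
  have hPN : D = P - N := by
    rw [hP, hN, ← cfc_sub _ _ D (continuousOn_spectrum D _) (continuousOn_spectrum D _)]
    conv_lhs => rw [hDid]
    congr 1; funext x
    rcases le_total 0 x with h | h <;> simp [h]
  have hNP : N * P = 0 := by
    rw [hP, hN, cfc_mul', ← cfc_zero ℝ D]
    congr 1; funext x
    rcases le_total 0 x with h | h <;> simp [h]
  have hQD : Q * D = -N := by
    conv_lhs => rw [hDid, hQ]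
    rw [cfc_mul', hN, ← cfc_neg]
    congr 1; funext x
    rcases lt_or_ge 0 x with h | h
    · simp [h, h.le]
    · simp [h, not_lt.mpr h]
  have hDQ : D * Q = -N := by
    conv_lhs => rw [hDid, hQ]
    rw [cfc_mul', hN, ← cfc_neg]
    congr 1; funext x
    rcases lt_or_ge 0 x with h | h
    · simp [h, h.le]
    · simp [h, not_lt.mpr h]
  have hPp : P.PosSemidef := posSemidef_cfc D fun x => le_max_right _ _
  have hNp : N.PosSemidef := posSemidef_cfc D fun x => le_max_right _ _
  refine ⟨1 - Q, ⟨?_, ?_⟩, ?_⟩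
  · rw [← cfc_one ℝ D, hQ, ← cfc_sub _ _ D (continuousOn_spectrum D _) (continuousOn_spectrum D _)]
    exact posSemidef_cfc D fun x => by by_cases h : 0 < x <;> simp [h]
  · rw [sub_sub_cancel]
    exact posSemidef_cfc D fun x => by by_cases h : 0 < x <;> simp [h]
  · have hXe : X = Y + D := by rw [hD]; abel
    have e1 : (Q * (X * X)).trace.re =
        (Q * (Y * Y)).trace.re - 2 * (N * Y).trace.re + (N * N).trace.re := by
      have h1 : Q * (X * X) = Q * (Y * Y) + Q * Y * D + Q * D * Y + Q * D * D := by
        rw [hXe]; noncomm_ring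
      have h2 : (Q * Y * D).trace = -(N * Y).trace := by
        rw [Matrix.trace_mul_comm, ← Matrix.mul_assoc, hDQ, Matrix.neg_mul, Matrix.trace_neg]
      have h3 : N * D = - (N * N) := by rw [hPN, Matrix.mul_sub, hNP, zero_sub]
      rw [h1, hQD, Matrix.trace_add, Matrix.trace_add, Matrix.trace_add, h2, Matrix.neg_mul,
        Matrix.neg_mul, h3, neg_neg, Matrix.trace_neg]
      simp only [Complex.add_re, Complex.neg_re]; ring
    have e2 : (X * Y).trace.re = (Y * Y).trace.re + (P * Y).trace.re - (N * Y).trace.re := by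
      rw [hXe, hPN, Matrix.add_mul, Matrix.sub_mul, Matrix.trace_add, Matrix.trace_sub]
      simp only [Complex.add_re, Complex.sub_re]; ring
    have e3 : (N * X).trace.re = (N * Y).trace.re - (N * N).trace.re := by
      rw [hXe, hPN, Matrix.mul_add, Matrix.mul_sub, hNP, zero_sub, Matrix.trace_add,
        Matrix.trace_neg]
      simp only [Complex.add_re, Complex.neg_re]; ring
    have e4 := re_trace_mul_nonneg hNp hX
    have e5 := re_trace_mul_nonneg hPp hY
    rw [sub_sub_cancel, e1, e2, Matrix.sub_mul, Matrix.one_mul, Matrix.trace_sub, Complex.sub_re]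
    linarith

/-- A pseudo-inverse of a positive semidefinite matrix. -/
lemma exists_pseudoInverse {S : Matrix ι ι ℂ} (hS : S.PosSemidef) :
    ∃ R : Matrix ι ι ℂ, R.conjTranspose = R ∧ S * S * R = S ∧ R * (S * S) = S ∧
      (1 - R * (S * S) * R).PosSemidef := by
  have hSs : IsSelfAdjoint S := hS.1.isSelfAdjoint
  -- Since `0⁻¹ = 0`, `R` inverts `S` on its support and vanishes on the kernel.
  set R := cfc (fun x : ℝ => x⁻¹) S with hR
  have hSid : S = cfc (fun x : ℝ => x) S := (cfc_id' ℝ S).symm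
  have hSS : S * S = cfc (fun x : ℝ => x * x) S := by
    conv_lhs => rw [hSid]
    rw [cfc_mul']
  have h2 : R * (S * S) = S := by
    rw [hSS, hR, cfc_mul']
    conv_rhs => rw [hSid]
    congr 1; funext x
    by_cases h : x = 0
    · simp [h]
    · field_simp
  refine ⟨R, (cfc_predicate _ S : IsSelfAdjoint R), ?_, h2, ?_⟩
  · rw [hSS, hR, cfc_mul']
    conv_rhs => rw [hSid]
    congr 1; funext x
    by_cases h : x = 0
    · simp [h]
    · field_simp
  · rw [h2]
    conv in S * R => rw [hSid, hR]
    rw [cfc_mul', ← cfc_one ℝ S,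
      ← cfc_sub _ _ S (continuousOn_spectrum S _) (continuousOn_spectrum S _)]
    refine posSemidef_cfc S fun x => ?_
    by_cases h : x = 0 <;> simp [h]

/-- `C` is a contraction. -/
def IsContraction (C : Matrix ι ι ℂ) : Prop := (1 - C.conjTranspose * C).PosSemidef

lemma IsContraction.mul {C D : Matrix ι ι ℂ} (hC : IsContraction C) (hD : IsContraction D) :
    IsContraction (C * D) := by
  have h := (hC.conjTranspose_mul_mul_same D).add hD
  unfold IsContraction
  convert h using 1
  rw [Matrix.conjTranspose_mul]; noncomm_ring

/-- Rests on `1 - C C† = C (1 - C† C) C† + (1 - C C†)²`. -/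
lemma IsContraction.conjTranspose {C : Matrix ι ι ℂ} (hC : IsContraction C) :
    IsContraction C.conjTranspose := by
  have h := (hC.mul_mul_conjTranspose_same C).add
    (Matrix.posSemidef_conjTranspose_mul_self (1 - C * C.conjTranspose))
  unfold IsContraction
  convert h using 1
  simp only [Matrix.conjTranspose_sub, Matrix.conjTranspose_mul, Matrix.conjTranspose_one,
    Matrix.conjTranspose_conjTranspose]
  noncomm_ring

/-- The polar decomposition `M = U √(M† M)` with a contraction `U`. -/
lemma exists_polar (M : Matrix ι ι ℂ) : ∃ U, IsContraction U ∧
    M = U * CFC.sqrt (M.conjTranspose * M) ∧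
    U.conjTranspose * M = CFC.sqrt (M.conjTranspose * M) := by
  have hM := Matrix.posSemidef_conjTranspose_mul_self M
  set N := CFC.sqrt (M.conjTranspose * M) with hN
  have hNp : N.PosSemidef := posSemidef_sqrt _
  have hNN : N * N = M.conjTranspose * M := sqrt_mul_sqrt hM
  obtain ⟨R, hR, h1, h2, h3⟩ := exists_pseudoInverse hNp
  refine ⟨M * R, ?_, ?_, ?_⟩
  · unfold IsContraction
    rwa [Matrix.conjTranspose_mul, hR, Matrix.mul_assoc, ← Matrix.mul_assoc _ M, ← hNN,
      ← Matrix.mul_assoc]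
  -- `1 - R N` projects onto the kernel of `N = |M|`, which is the kernel of `M`.
  · have h0 : (M * (1 - R * N)).conjTranspose * (M * (1 - R * N)) = 0 := by
      rw [Matrix.conjTranspose_mul, Matrix.mul_assoc, ← Matrix.mul_assoc _ M, ← hNN,
        Matrix.mul_sub (N * N), ← Matrix.mul_assoc (N * N), h1, Matrix.mul_one, sub_self,
        Matrix.mul_zero]
    rw [Matrix.conjTranspose_mul_self_eq_zero, Matrix.mul_sub, Matrix.mul_one, sub_eq_zero] at h0
    rw [Matrix.mul_assoc]; exact h0
  · rw [Matrix.conjTranspose_mul, hR, Matrix.mul_assoc, ← hNN, h2]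

/-- `2 - K - K† = (1 - K)† (1 - K) + (1 - K† K)` is positive semidefinite; pair it with `N`. -/
lemma re_trace_mul_le_of_isContraction {N K : Matrix ι ι ℂ} (hN : N.PosSemidef)
    (hK : IsContraction K) : (N * K).trace.re ≤ N.trace.re := by
  have h := (Matrix.posSemidef_conjTranspose_mul_self (1 - K)).add hK
  have h1 := re_trace_mul_nonneg hN h
  have h2 : (1 - K).conjTranspose * (1 - K) + (1 - K.conjTranspose * K) =
      1 + 1 - K - K.conjTranspose := by
    rw [Matrix.conjTranspose_sub, Matrix.conjTranspose_one]; noncomm_ring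
  have h3 : (N * K.conjTranspose).trace.re = (N * K).trace.re := by
    rw [← re_trace_conjTranspose (N * K), Matrix.conjTranspose_mul, hN.1.eq, re_trace_mul_comm]
  rw [h2, Matrix.mul_sub, Matrix.mul_sub, Matrix.trace_sub, Matrix.trace_sub, Complex.sub_re,
    Complex.sub_re, h3, mul_add, mul_one, Matrix.trace_add, Complex.add_re] at h1
  linarith

lemma re_trace_mul_le_traceNorm (M : Matrix ι ι ℂ) {C : Matrix ι ι ℂ} (hC : IsContraction C) :
    (M * C).trace.re ≤ traceNorm M := by
  obtain ⟨U, hU, h1, -⟩ := exists_polar M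
  conv_lhs => rw [h1, Matrix.mul_assoc, re_trace_mul_comm, Matrix.mul_assoc]
  exact re_trace_mul_le_of_isContraction (posSemidef_sqrt _) (hC.mul hU)

/-- The adjoint of the polar factor attains the supremum of `Re tr (M C)` over contractions. -/
lemma exists_traceNorm_eq (M : Matrix ι ι ℂ) :
    ∃ C, IsContraction C ∧ traceNorm M = (M * C).trace.re := by
  obtain ⟨U, hU, -, h2⟩ := exists_polar M
  exact ⟨_, hU.conjTranspose, by rw [re_trace_mul_comm, h2]; rfl⟩

/-- Take `V i = X i * A^(-1/2)` with the pseudo-inverse root: `√A = A * A^(-1/2)`, and the `(V i)†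
(V i)` sum to the support projection of `A`, so each is at most `1`. -/
lemma exists_sqrt_factor {κ : Type*} [Fintype κ] (X : κ → Matrix ι ι ℂ) :
    ∃ V : κ → Matrix ι ι ℂ, (∀ i, IsContraction (V i)) ∧
      CFC.sqrt (∑ i, (X i).conjTranspose * X i) = ∑ i, (X i).conjTranspose * V i := by
  classical
  have hp : ∀ s : Finset κ, (∑ i ∈ s, (X i).conjTranspose * X i).PosSemidef := fun s =>
    Matrix.posSemidef_sum s fun i _ => Matrix.posSemidef_conjTranspose_mul_self (X i)
  set A := ∑ i, (X i).conjTranspose * X i with hA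
  have hAA := sqrt_mul_sqrt (hp Finset.univ)
  obtain ⟨R, hR, h1, -, h3⟩ := exists_pseudoInverse (posSemidef_sqrt A)
  rw [hAA] at h1 h3
  refine ⟨fun i => X i * R, fun i => ?_, ?_⟩
  · have h4 := h3.add ((hp (Finset.univ.erase i)).conjTranspose_mul_mul_same R)
    unfold IsContraction
    convert h4 using 1
    rw [← Finset.add_sum_erase _ _ (Finset.mem_univ i), Matrix.conjTranspose_mul, hR]
    noncomm_ring
  · rw [← h1, Finset.sum_mul]
    exact Finset.sum_congr rfl fun i _ => Matrix.mul_assoc _ _ _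

/-- Factoring both roots makes the trace a double sum of terms `tr (X i * (Y j)† * contraction)`,
each bounded by a trace norm. -/
lemma re_trace_sqrt_mul_sqrt_le {κ κ' : Type*} [Fintype κ] [Fintype κ']
    (X : κ → Matrix ι ι ℂ) (Y : κ' → Matrix ι ι ℂ) :
    (CFC.sqrt (∑ i, (X i).conjTranspose * X i) *
      CFC.sqrt (∑ j, (Y j).conjTranspose * Y j)).trace.re ≤
      ∑ i, ∑ j, traceNorm (X i * (Y j).conjTranspose) := by
  obtain ⟨V, hV, hV'⟩ := exists_sqrt_factor X
  obtain ⟨W, hW, hW'⟩ := exists_sqrt_factor Y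
  have h := (posSemidef_sqrt (∑ i, (X i).conjTranspose * X i)).1.eq
  rw [← h, hV', hW', Matrix.conjTranspose_sum, Finset.sum_mul, Matrix.trace_sum, Complex.re_sum]
  refine Finset.sum_le_sum fun i _ => ?_
  rw [Finset.mul_sum, Matrix.trace_sum, Complex.re_sum]
  refine Finset.sum_le_sum fun j _ => ?_
  rw [Matrix.conjTranspose_mul, Matrix.conjTranspose_conjTranspose, Matrix.mul_assoc,
    re_trace_mul_comm, ← Matrix.mul_assoc (X i), Matrix.mul_assoc]
  exact re_trace_mul_le_traceNorm _ ((hW j).mul (hV i).conjTranspose)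

end Matrix

/-! ### Fidelity as a lower bound on the error of a test -/

section Fidelity

variable {ι : Type*} [Fintype ι] [DecidableEq ι]

lemma IsTest.one_sub {T : Matrix ι ι ℂ} (hT : IsTest T) : IsTest (1 - T) :=
  ⟨hT.2, by rw [sub_sub_cancel]; exact hT.1⟩

lemma IsTest.sub_mul_self {T : Matrix ι ι ℂ} (hT : IsTest T) : (T - T * T).PosSemidef := by
  have h := hT.2.mul_mul_conjTranspose_same (CFC.sqrt T)
  have h1 : (CFC.sqrt T * (1 - T) * (CFC.sqrt T).conjTranspose) = T - T * T := by
    have h2 := sqrt_mul_sqrt hT.1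
    rw [(posSemidef_sqrt T).1.eq]
    set S := CFC.sqrt T
    rw [← h2]; noncomm_ring
  rwa [h1] at h

lemma isTest_zero : IsTest (0 : Matrix ι ι ℂ) :=
  ⟨Matrix.PosSemidef.zero, by rw [sub_zero]; exact Matrix.PosSemidef.one⟩

lemma IsTest.re_trace_mul_nonneg {T ρ : Matrix ι ι ℂ} (hT : IsTest T) (hρ : IsState ρ) :
    0 ≤ (T * ρ).trace.re :=
  CompositeQHT.re_trace_mul_nonneg hT.1 hρ.1

lemma IsTest.re_trace_mul_le_one {T ρ : Matrix ι ι ℂ} (hT : IsTest T) (hρ : IsState ρ) :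
    (T * ρ).trace.re ≤ 1 := by
  have h := CompositeQHT.re_trace_mul_nonneg hT.2 hρ.1
  rw [Matrix.sub_mul, Matrix.one_mul, Matrix.trace_sub, hρ.2, Complex.sub_re, Complex.one_re] at h
  linarith

lemma errorProb_nonneg {T ρ σ : Matrix ι ι ℂ} {p : ℝ} (hp0 : 0 ≤ p) (hp1 : p ≤ 1)
    (hT : IsTest T) (hρ : IsState ρ) (hσ : IsState σ) : 0 ≤ errorProb T p ρ σ :=
  add_nonneg (mul_nonneg hp0 (hT.one_sub.re_trace_mul_nonneg hρ))
    (mul_nonneg (sub_nonneg.mpr hp1) (hT.re_trace_mul_nonneg hσ))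

lemma errorProb_le_one {T ρ σ : Matrix ι ι ℂ} {p : ℝ} (hp0 : 0 ≤ p) (hp1 : p ≤ 1)
    (hT : IsTest T) (hρ : IsState ρ) (hσ : IsState σ) : errorProb T p ρ σ ≤ 1 := by
  have h1 := mul_le_mul_of_nonneg_left (hT.one_sub.re_trace_mul_le_one hρ) hp0
  have h2 := mul_le_mul_of_nonneg_left (hT.re_trace_mul_le_one hσ) (sub_nonneg.mpr hp1)
  unfold errorProb; linarith

omit [DecidableEq ι] in
-- Cauchy–Schwarz in linearized form: `‖t A - B‖² ≥ 0` divided by `t`.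
lemma re_trace_conjTranspose_mul_le (A B : Matrix ι ι ℂ) {t : ℝ} (ht : 0 < t) :
    2 * (A.conjTranspose * B).trace.re ≤
      t * (A.conjTranspose * A).trace.re + t⁻¹ * (B.conjTranspose * B).trace.re := by
  have h := re_trace_nonneg (Matrix.posSemidef_conjTranspose_mul_self (t • A - B))
  have h1 : (B.conjTranspose * A).trace.re = (A.conjTranspose * B).trace.re := by
    rw [← re_trace_conjTranspose, Matrix.conjTranspose_mul, Matrix.conjTranspose_conjTranspose]
  simp only [Matrix.conjTranspose_sub, Matrix.conjTranspose_smul, star_trivial, Matrix.sub_mul,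
    Matrix.mul_sub, Matrix.smul_mul, Matrix.mul_smul, Matrix.trace_sub, Matrix.trace_smul,
    Complex.sub_re, Complex.smul_re, smul_eq_mul, h1] at h
  have h2 := mul_nonneg (inv_pos.mpr ht).le h
  have h3 : t⁻¹ * t = 1 := inv_mul_cancel₀ ht.ne'
  have h4 : t⁻¹ * (t * (t * (A.conjTranspose * A).trace.re - (A.conjTranspose * B).trace.re) -
      (t * (A.conjTranspose * B).trace.re - (B.conjTranspose * B).trace.re)) =
      (t⁻¹ * t) * (t * (A.conjTranspose * A).trace.re) -
      2 * ((t⁻¹ * t) * (A.conjTranspose * B).trace.re) +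
      t⁻¹ * (B.conjTranspose * B).trace.re := by ring
  rw [h4, h3] at h2
  linarith

lemma IsTest.re_trace_mul_mul_le {T M : Matrix ι ι ℂ} (hT : IsTest T) (hM : M.PosSemidef) :
    (T * T * M).trace.re ≤ (T * M).trace.re := by
  have h := CompositeQHT.re_trace_mul_nonneg hT.sub_mul_self hM
  rw [Matrix.sub_mul, Matrix.trace_sub, Complex.sub_re] at h
  linarith

lemma re_trace_le_one_of_isContraction {σ C : Matrix ι ι ℂ} (hσ : IsState σ)
    (hC : IsContraction C) :
    ((CFC.sqrt σ * C).conjTranspose * (CFC.sqrt σ * C)).trace.re ≤ 1 := by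
  have h := re_trace_mul_nonneg hC.conjTranspose hσ.1
  have e : ((CFC.sqrt σ * C).conjTranspose * (CFC.sqrt σ * C)).trace =
      (C * C.conjTranspose * σ).trace := by
    rw [Matrix.conjTranspose_mul, (posSemidef_sqrt σ).1.eq, Matrix.mul_assoc,
      Matrix.trace_mul_comm, ← Matrix.mul_assoc (CFC.sqrt σ), sqrt_mul_sqrt hσ.1,
      Matrix.mul_assoc, Matrix.trace_mul_comm, Matrix.mul_assoc]
  rw [Matrix.conjTranspose_conjTranspose, Matrix.sub_mul, Matrix.one_mul, Matrix.trace_sub, hσ.2,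
    Complex.sub_re, Complex.one_re] at h
  rw [e]; linarith

/-- Write the fidelity as `Re tr (√ρ √σ C)` with a contraction `C`, insert `1 = (1 - T) + T` between
the roots, and apply weighted Cauchy–Schwarz to each half. `T² ≤ T` turns the squares into error
probabilities. The free weights `s`, `t` allow for unequal priors. -/
lemma two_mul_fidelity_le {T ρ σ : Matrix ι ι ℂ} (hT : IsTest T) (hρ : IsState ρ) (hσ : IsState σ)
    {s t : ℝ} (hs : 0 < s) (ht : 0 < t) :
    2 * fidelity ρ σ ≤ s * ((1 - T) * ρ).trace.re + s⁻¹ + (t * (T * σ).trace.re + t⁻¹) := by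
  obtain ⟨C, hC, hF⟩ := exists_traceNorm_eq (CFC.sqrt ρ * CFC.sqrt σ)
  have hρs := (posSemidef_sqrt ρ).1.eq
  have hσs := (posSemidef_sqrt σ).1.eq
  have hρρ := sqrt_mul_sqrt hρ.1
  have hσσ := sqrt_mul_sqrt hσ.1
  have hT1 := hT.one_sub.1.1.eq
  have hT0 := hT.1.1.eq
  have h1 := re_trace_conjTranspose_mul_le ((1 - T) * CFC.sqrt ρ) (CFC.sqrt σ * C) hs
  have h2 := re_trace_conjTranspose_mul_le (T * CFC.sqrt σ) (CFC.sqrt ρ * C.conjTranspose) ht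
  have h3 := re_trace_le_one_of_isContraction hσ hC
  have h4 := re_trace_le_one_of_isContraction hρ hC.conjTranspose
  have h5 : (((1 - T) * CFC.sqrt ρ).conjTranspose * ((1 - T) * CFC.sqrt ρ)).trace.re ≤
      ((1 - T) * ρ).trace.re := by
    refine le_of_eq_of_le ?_ (hT.one_sub.re_trace_mul_mul_le hρ.1)
    rw [Matrix.conjTranspose_mul, hρs, hT1, re_trace_mul_comm, Matrix.mul_assoc,
      ← Matrix.mul_assoc (CFC.sqrt ρ), hρρ, ← Matrix.mul_assoc, re_trace_mul_comm,
      ← Matrix.mul_assoc]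
  have h6 : ((T * CFC.sqrt σ).conjTranspose * (T * CFC.sqrt σ)).trace.re ≤
      (T * σ).trace.re := by
    refine le_of_eq_of_le ?_ (hT.re_trace_mul_mul_le hσ.1)
    rw [Matrix.conjTranspose_mul, hσs, hT0, re_trace_mul_comm, Matrix.mul_assoc,
      ← Matrix.mul_assoc (CFC.sqrt σ), hσσ, ← Matrix.mul_assoc, re_trace_mul_comm,
      ← Matrix.mul_assoc]
  have h7 : fidelity ρ σ = (((1 - T) * CFC.sqrt ρ).conjTranspose * (CFC.sqrt σ * C)).trace.re +
      ((T * CFC.sqrt σ).conjTranspose * (CFC.sqrt ρ * C.conjTranspose)).trace.re := by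
    rw [← re_trace_conjTranspose ((T * CFC.sqrt σ).conjTranspose * _)]
    simp only [Matrix.conjTranspose_mul, Matrix.conjTranspose_conjTranspose, hρs, hσs, hT1]
    rw [re_trace_mul_comm (C * CFC.sqrt ρ), ← Matrix.mul_assoc, re_trace_mul_comm, fidelity, hF,
      ← Complex.add_re, ← Matrix.trace_add]
    rw [Matrix.trace_add, Matrix.trace_mul_comm (T * CFC.sqrt σ), ← Matrix.trace_add,
      Matrix.trace_mul_comm _ C]
    congr 2; noncomm_ring
  have h8 := mul_le_mul_of_nonneg_left h5 hs.le
  have h9 := mul_le_mul_of_nonneg_left h6 ht.le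
  have h10 := mul_le_mul_of_nonneg_left h3 (inv_pos.mpr hs).le
  have h11 := mul_le_mul_of_nonneg_left h4 (inv_pos.mpr ht).le
  linarith

lemma fidelity_nonneg (ρ σ : Matrix ι ι ℂ) : 0 ≤ fidelity ρ σ :=
  re_trace_nonneg (posSemidef_sqrt _)

/-- The lower bound on the error probability of a test in terms of the fidelity. -/
lemma mul_fidelity_sq_le_errorProb {T ρ σ : Matrix ι ι ℂ} {p : ℝ} (hp0 : 0 < p) (hp1 : p < 1)
    (hT : IsTest T) (hρ : IsState ρ) (hσ : IsState σ) :
    p * (1 - p) * fidelity ρ σ ^ 2 ≤ errorProb T p ρ σ := by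
  have hq : 0 < 1 - p := sub_pos.mpr hp1
  rcases (fidelity_nonneg ρ σ).eq_or_lt with h0 | hF
  · rw [← h0]; simpa using errorProb_nonneg hp0.le hp1.le hT hρ hσ
  · set F := fidelity ρ σ
    -- These weights, after multiplication by `p (1 - p) F`, give the two errors the coefficients
    -- `p` and `1 - p`; the inverse terms add up to `p (1 - p) F²`.
    have h := two_mul_fidelity_le hT hρ hσ (s := ((1 - p) * F)⁻¹) (t := (p * F)⁻¹)
      (by positivity) (by positivity)
    have h1 := mul_le_mul_of_nonneg_left h (by positivity : 0 ≤ p * (1 - p) * F)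
    have h2 : p * (1 - p) * F * (((1 - p) * F)⁻¹ * ((1 - T) * ρ).trace.re + ((1 - p) * F)⁻¹⁻¹ +
        ((p * F)⁻¹ * (T * σ).trace.re + (p * F)⁻¹⁻¹)) =
        errorProb T p ρ σ + p * (1 - p) * F ^ 2 := by
      unfold errorProb; field_simp; ring
    rw [h2] at h1
    nlinarith [h1]

lemma fidelity_le_one {ρ σ : Matrix ι ι ℂ} (hρ : IsState ρ) (hσ : IsState σ) :
    fidelity ρ σ ≤ 1 := by
  refine le_of_mul_le_mul_left (le_of_forall_pos_le_add fun ε hε => ?_) two_pos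
  -- With `T = 0` and `s = 1`, only `t⁻¹ = ε` exceeds the wanted bound.
  have h := two_mul_fidelity_le isTest_zero hρ hσ one_pos (inv_pos.mpr hε)
  rw [sub_zero, Matrix.one_mul, hρ.2, Matrix.zero_mul, Matrix.trace_zero, Complex.zero_re,
    Complex.one_re, inv_inv, inv_one] at h
  linarith

lemma mul_eq_zero_of_fidelity_eq_zero {ρ σ : Matrix ι ι ℂ} (hρ : ρ.PosSemidef)
    (hσ : σ.PosSemidef) (h : fidelity ρ σ = 0) : ρ * σ = 0 := by
  set M := CFC.sqrt ρ * CFC.sqrt σ with hM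
  have hp := posSemidef_sqrt (M.conjTranspose * M)
  have h1 : CFC.sqrt (M.conjTranspose * M) = 0 := by
    refine hp.trace_eq_zero_iff.mp (Complex.ext h ?_)
    exact (Complex.le_def.mp hp.trace_nonneg).2.symm
  have h2 := sqrt_mul_sqrt (Matrix.posSemidef_conjTranspose_mul_self M)
  rw [h1, Matrix.mul_zero, eq_comm, Matrix.conjTranspose_mul_self_eq_zero] at h2
  rw [← sqrt_mul_sqrt hρ, ← sqrt_mul_sqrt hσ, Matrix.mul_assoc,
    ← Matrix.mul_assoc (CFC.sqrt ρ) (CFC.sqrt σ), ← hM, h2, Matrix.zero_mul, Matrix.mul_zero]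

end Fidelity

/-! ### Multiplicativity under tensor powers -/

section TensorPow

variable {d : ℕ}

lemma tensorPow_mul (A B : Matrix (Fin d) (Fin d) ℂ) (n : ℕ) :
    tensorPow (A * B) n = tensorPow A n * tensorPow B n := by
  ext f g
  simp only [tensorPow, Matrix.of_apply, Matrix.mul_apply, ← Finset.prod_mul_distrib]
  rw [Finset.prod_univ_sum, Fintype.piFinset_univ]

lemma conjTranspose_tensorPow (A : Matrix (Fin d) (Fin d) ℂ) (n : ℕ) :
    (tensorPow A n).conjTranspose = tensorPow A.conjTranspose n := by
  ext f g
  simp [tensorPow, Matrix.conjTranspose_apply]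

lemma trace_tensorPow (A : Matrix (Fin d) (Fin d) ℂ) (n : ℕ) :
    (tensorPow A n).trace = A.trace ^ n := by
  simp only [Matrix.trace, Matrix.diag_apply, tensorPow, Matrix.of_apply]
  rw [← Fintype.piFinset_univ, ← Finset.prod_univ_sum (fun _ => Finset.univ) fun _ j => A j j]
  simp

lemma posSemidef_tensorPow {A : Matrix (Fin d) (Fin d) ℂ} (hA : A.PosSemidef) (n : ℕ) :
    (tensorPow A n).PosSemidef := by
  rw [← sqrt_mul_sqrt hA, tensorPow_mul]
  nth_rw 1 [← (posSemidef_sqrt A).1.eq]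
  rw [← conjTranspose_tensorPow]
  exact Matrix.posSemidef_conjTranspose_mul_self _

lemma IsState.tensorPow {ρ : Matrix (Fin d) (Fin d) ℂ} (hρ : IsState ρ) (n : ℕ) :
    IsState (tensorPow ρ n) :=
  ⟨posSemidef_tensorPow hρ.1 n, by rw [trace_tensorPow, hρ.2, one_pow]⟩

lemma sqrt_tensorPow {A : Matrix (Fin d) (Fin d) ℂ} (hA : A.PosSemidef) (n : ℕ) :
    CFC.sqrt (tensorPow A n) = tensorPow (CFC.sqrt A) n :=
  CFC.sqrt_unique (by rw [← tensorPow_mul, sqrt_mul_sqrt hA])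
    (posSemidef_tensorPow (posSemidef_sqrt A) n).nonneg

lemma traceNorm_tensorPow (A : Matrix (Fin d) (Fin d) ℂ) (n : ℕ) :
    traceNorm (tensorPow A n) = traceNorm A ^ n := by
  have hp := posSemidef_sqrt (A.conjTranspose * A)
  have h : (CFC.sqrt (A.conjTranspose * A)).trace = (traceNorm A : ℂ) :=
    Complex.ext rfl (Complex.le_def.mp hp.trace_nonneg).2.symm
  rw [traceNorm, conjTranspose_tensorPow, ← tensorPow_mul,
    sqrt_tensorPow (Matrix.posSemidef_conjTranspose_mul_self A), trace_tensorPow, h,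
    ← Complex.ofReal_pow, Complex.ofReal_re]

lemma fidelity_tensorPow {ρ σ : Matrix (Fin d) (Fin d) ℂ} (hρ : ρ.PosSemidef) (hσ : σ.PosSemidef)
    (n : ℕ) : fidelity (tensorPow ρ n) (tensorPow σ n) = fidelity ρ σ ^ n := by
  rw [fidelity, sqrt_tensorPow hρ, sqrt_tensorPow hσ, ← tensorPow_mul, traceNorm_tensorPow]; rfl

end TensorPow

/-! ### Minimax over tests -/

section Minimax

variable {ι : Type*} [Fintype ι] [DecidableEq ι]

open scoped Matrix.Norms.L2Operator in
lemma isCompact_setOf_isTest : IsCompact {T : Matrix ι ι ℂ | IsTest T} := by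
  have : ProperSpace (Matrix ι ι ℂ) := FiniteDimensional.proper ℂ _
  have h : {T : Matrix ι ι ℂ | IsTest T} = Set.Icc 0 1 := by
    ext T
    simp only [IsTest, Set.mem_ofPred_eq, Set.mem_Icc, ← Matrix.nonneg_iff_posSemidef, sub_nonneg]
  rw [h]
  refine (isCompact_closedBall (0 : Matrix ι ι ℂ) 1).of_isClosed_subset isClosed_Icc fun T hT => ?_
  rw [mem_closedBall_zero_iff]
  exact CStarAlgebra.norm_le_one_iff_of_nonneg T hT.1 |>.mpr hT.2

lemma convex_setOf_isTest : Convex ℝ {T : Matrix ι ι ℂ | IsTest T} := by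
  intro T hT U hU a b ha hb hab
  refine ⟨(hT.1.smul ha).add (hU.1.smul hb), ?_⟩
  convert (hT.2.smul ha).add (hU.2.smul hb) using 1
  have h1 : (1 : Matrix ι ι ℂ) = a • 1 + b • 1 := by rw [← add_smul, hab, one_smul]
  nth_rw 1 [h1]
  rw [smul_sub, smul_sub]; abel

lemma continuous_errorProb (p : ℝ) :
    Continuous fun x : Matrix ι ι ℂ × Matrix ι ι ℂ × Matrix ι ι ℂ =>
      errorProb x.1 p x.2.1 x.2.2 := by
  unfold errorProb
  have h1 : Continuous fun x : Matrix ι ι ℂ × Matrix ι ι ℂ × Matrix ι ι ℂ =>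
      ((1 - x.1) * x.2.1).trace :=
    ((continuous_const.sub continuous_fst).matrix_mul
      (continuous_fst.comp continuous_snd)).matrix_trace
  have h2 : Continuous fun x : Matrix ι ι ℂ × Matrix ι ι ℂ × Matrix ι ι ℂ =>
      (x.1 * x.2.2).trace :=
    (continuous_fst.matrix_mul (continuous_snd.comp continuous_snd)).matrix_trace
  exact (continuous_const.mul (Complex.continuous_re.comp h1)).add
    (continuous_const.mul (Complex.continuous_re.comp h2))

lemma errorProb_combo_left (p : ℝ) (σ₁ σ₂ T U : Matrix ι ι ℂ) {a b : ℝ} (hab : a + b = 1) :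
    errorProb (a • T + b • U) p σ₁ σ₂ = a * errorProb T p σ₁ σ₂ + b * errorProb U p σ₁ σ₂ := by
  obtain rfl : b = 1 - a := by linarith
  simp only [errorProb, Matrix.sub_mul, Matrix.add_mul, Matrix.smul_mul, Matrix.trace_sub,
    Matrix.trace_add, Matrix.trace_smul, Complex.sub_re, Complex.add_re, Complex.smul_re,
    smul_eq_mul]
  ring

lemma errorProb_combo_right (p : ℝ) (T σ₁ σ₂ τ₁ τ₂ : Matrix ι ι ℂ) (a b : ℝ) :
    errorProb T p (a • σ₁ + b • τ₁) (a • σ₂ + b • τ₂) =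
      a * errorProb T p σ₁ σ₂ + b * errorProb T p τ₁ τ₂ := by
  simp only [errorProb, Matrix.mul_add, Matrix.mul_smul,
    Matrix.trace_add, Matrix.trace_smul, Complex.add_re, Complex.smul_re, smul_eq_mul]
  ring

/-- The minimax theorem for tests: if every pair of mixtures can be told apart with error at most
`b`, then one test does so for all pairs. -/
lemma exists_isTest_forall_errorProb_le {S₁ S₂ : Set (Matrix ι ι ℂ)} (p b : ℝ)
    (h : ∀ σ₁ ∈ convexHull ℝ S₁, ∀ σ₂ ∈ convexHull ℝ S₂, ∃ T, IsTest T ∧ errorProb T p σ₁ σ₂ ≤ b) :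
    ∃ T, IsTest T ∧ ∀ σ₁ ∈ S₁, ∀ σ₂ ∈ S₂, errorProb T p σ₁ σ₂ ≤ b := by
  by_contra! hcon
  set f := fun (T : Matrix ι ι ℂ) (σ : Matrix ι ι ℂ × Matrix ι ι ℂ) => errorProb T p σ.1 σ.2
  set Y := convexHull ℝ S₁ ×ˢ convexHull ℝ S₂
  have hX : ({T : Matrix ι ι ℂ | IsTest T}).Nonempty := ⟨0, isTest_zero⟩
  have hY : Convex ℝ Y := (convex_convexHull ℝ S₁).prod (convex_convexHull ℝ S₂)
  have hlsc : ∀ σ ∈ Y, LowerSemicontinuousOn (fun T => f T σ) {T | IsTest T} := fun σ _ =>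
    ((continuous_errorProb p).comp
      (continuous_id.prodMk continuous_const)).lowerSemicontinuous.lowerSemicontinuousOn _
  -- If every test exceeds `b` on some pair, compactness leaves finitely many pairs that defeat all
  -- tests; Sion then merges them into one pair of mixtures on which every test exceeds `b`.
  obtain ⟨s, hs⟩ :=
    (LowerSemicontinuousOn.inter_biInter_preimage_Iic_eq_empty_iff_exists_finset
      isCompact_setOf_isTest hlsc (c := b)).mp <| by
    refine Set.eq_empty_of_forall_notMem fun T ⟨hT, hT'⟩ => ?_
    obtain ⟨σ₁, h₁, σ₂, h₂, hlt⟩ := hcon T hT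
    exact hlt.not_ge (Set.mem_iInter₂.mp hT' (σ₁, σ₂)
      ⟨subset_convexHull ℝ _ h₁, subset_convexHull ℝ _ h₂⟩)
  obtain ⟨σ, hσ, hlt⟩ := Sion.exists_lt_iInf_of_lt_iInf_of_finite hX isCompact_setOf_isTest hlsc
    (fun σ _ => ConvexOn.quasiconvexOn ⟨convex_setOf_isTest, fun T _ U _ a b _ _ hab =>
      (errorProb_combo_left p σ.1 σ.2 T U hab).le⟩)
    hY
    (fun T _ => ((continuous_errorProb p).comp
      (continuous_const.prodMk continuous_id)).upperSemicontinuous.upperSemicontinuousOn _)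
    (fun T _ => ConcaveOn.quasiconcaveOn ⟨hY, fun σ _ τ _ a b _ _ _ =>
      (errorProb_combo_right p T σ.1 σ.2 τ.1 τ.2 a b).ge⟩)
    convex_setOf_isTest (s.finite_toSet.image Subtype.val) (Subtype.coe_image_subset Y ↑s)
    (fun T hT => by
      obtain ⟨σ, hσ, hlt⟩ := hs T hT
      exact ⟨σ, ⟨σ, hσ, rfl⟩, hlt⟩)
  obtain ⟨T, hT, hle⟩ := h σ.1 hσ.1 σ.2 hσ.2
  exact (hlt T hT).not_ge hle

end Minimax

/-! ### Few-term mixtures of tensor powers -/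

section Caratheodory

/-- A real basis of the Hermitian `2 × 2` matrices. -/
def hermBasis : Fin 4 → Matrix (Fin 2) (Fin 2) ℂ :=
  ![!![1, 0; 0, 0], !![0, 0; 0, 1], !![0, 1; 1, 0], !![0, Complex.I; -Complex.I, 0]]

/-- The coordinates of a Hermitian matrix with respect to `hermBasis`. -/
def hermCoord (ρ : Matrix (Fin 2) (Fin 2) ℂ) : Fin 4 → ℝ :=
  ![(ρ 0 0).re, (ρ 1 1).re, (ρ 0 1).re, (ρ 0 1).im]

lemma sum_hermCoord_smul {ρ : Matrix (Fin 2) (Fin 2) ℂ} (hρ : ρ.IsHermitian) :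
    ∑ k, hermCoord ρ k • hermBasis k = ρ := by
  have h00 : (ρ 0 0).im = 0 := Complex.conj_eq_iff_im.mp (hρ.apply 0 0)
  have h11 : (ρ 1 1).im = 0 := Complex.conj_eq_iff_im.mp (hρ.apply 1 1)
  have h10 : ρ 1 0 = star (ρ 0 1) := (hρ.apply 1 0).symm
  ext i j
  fin_cases i <;> fin_cases j <;>
    simp [Fin.sum_univ_four, hermCoord, hermBasis, Complex.ext_iff, h00, h11, h10]

/-- The multiset of letters of a word. -/
def wordType {n : ℕ} (w : Fin n → Fin 4) : Sym (Fin 4) n :=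
  ⟨Finset.univ.val.map w, by simp⟩

/-- The symmetrized products of `hermBasis`, which span all tensor powers. -/
def symBasis {n : ℕ} (m : Sym (Fin 4) n) : Matrix (Fin n → Fin 2) (Fin n → Fin 2) ℂ :=
  ∑ w with wordType w = m, Matrix.of fun f g => ∏ i, hermBasis (w i) (f i) (g i)

/-- Expand the product over words in the four basis letters. The coefficient of a word depends only
on its multiset of letters, so words of one type can be grouped. -/
lemma tensorPow_mem_span {ρ : Matrix (Fin 2) (Fin 2) ℂ} (hρ : ρ.IsHermitian) (n : ℕ) :
    tensorPow ρ n ∈ Submodule.span ℝ (Set.range (symBasis (n := n))) := by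
  have h : tensorPow ρ n =
      ∑ m : Sym (Fin 4) n, ((m : Multiset (Fin 4)).map (hermCoord ρ)).prod • symBasis m := by
    simp only [symBasis, Finset.smul_sum]
    have h1 : ∀ m : Sym (Fin 4) n, ∀ w ∈ Finset.univ.filter fun w => wordType w = m,
        ((m : Multiset (Fin 4)).map (hermCoord ρ)).prod •
          Matrix.of (fun f g : Fin n → Fin 2 => ∏ i, hermBasis (w i) (f i) (g i)) =
        (∏ i, hermCoord ρ (w i)) •
          Matrix.of (fun f g : Fin n → Fin 2 => ∏ i, hermBasis (w i) (f i) (g i)) := by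
      intro m w hw
      obtain rfl := (Finset.mem_filter.mp hw).2
      rw [wordType, Sym.coe_mk, Multiset.map_map]; rfl
    rw [Finset.sum_congr rfl fun m _ => Finset.sum_congr rfl (h1 m), Finset.sum_fiberwise]
    ext f g
    conv_lhs => rw [← sum_hermCoord_smul hρ]
    simp only [tensorPow, Matrix.of_apply, Matrix.sum_apply, Matrix.smul_apply]
    rw [Finset.prod_univ_sum, Fintype.piFinset_univ]
    refine Finset.sum_congr rfl fun w _ => ?_
    simp only [Complex.real_smul, Finset.prod_mul_distrib, Complex.ofReal_prod]
  rw [h]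
  exact Submodule.sum_mem _ fun m _ => Submodule.smul_mem _ _ (Submodule.subset_span ⟨m, rfl⟩)

/-- Carathéodory's theorem for mixtures of tensor powers of qubit states. -/
lemma exists_mixture_of_mem_convexHull {D : Set (Matrix (Fin 2) (Fin 2) ℂ)}
    (hD : ∀ ρ ∈ D, IsState ρ) {n : ℕ} {σ : Matrix (Fin n → Fin 2) (Fin n → Fin 2) ℂ}
    (hσ : σ ∈ convexHull ℝ ((fun ρ => tensorPow ρ n) '' D)) :
    ∃ (κ : Type) (_ : Fintype κ) (ρ : κ → Matrix (Fin 2) (Fin 2) ℂ) (w : κ → ℝ),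
      (∀ i, ρ i ∈ D) ∧ (∀ i, 0 ≤ w i) ∧ ∑ i, w i = 1 ∧ ∑ i, w i • tensorPow (ρ i) n = σ ∧
      Fintype.card κ ≤ (n + 3).choose 3 := by
  obtain ⟨κ, _, z, w, hz, hind, hw, hw1, rfl⟩ := eq_pos_convex_span_of_mem_convexHull hσ
  choose ρ hρD hρz using fun i => hz ⟨i, rfl⟩
  refine ⟨κ, inferInstance, ρ, w, hρD, fun i => (hw i).le, hw1,
    Finset.sum_congr rfl fun i _ => by rw [← hρz i], ?_⟩
  -- All points have trace `1`, so the weights of a vanishing combination sum to zero and affine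
  -- independence becomes linear independence. This saves the extra term of the usual Carathéodory
  -- count.
  have hli : LinearIndependent ℝ z := by
    rw [linearIndependent_iff']
    rw [affineIndependent_iff] at hind
    intro s g hg
    refine hind s g ?_ hg
    have h := congrArg (fun A => (Matrix.trace A).re) hg
    simpa [Matrix.trace_sum, ← hρz, (((hD _ (hρD _)).tensorPow n).2)] using h
  have hspan : Set.range z ⊆ Submodule.span ℝ (Set.range (symBasis (n := n))) := by
    rintro _ ⟨i, rfl⟩
    rw [← hρz i]
    exact tensorPow_mem_span (hD _ (hρD i)).1.1 n
  refine (linearIndependent_le_span_aux' z hli _ hspan).trans ?_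
  refine (Fintype.card_range_le _).trans ?_
  rw [Sym.card_sym_eq_choose, Fintype.card_fin, show 4 + n - 1 = n + 3 by omega,
    Nat.choose_symm_add]

end Caratheodory

/-! ### Bounds on the min-max error -/

section CompositeError

lemma traceNorm_smul {ι : Type*} [Fintype ι] [DecidableEq ι] {c : ℝ} (hc : 0 ≤ c)
    (A : Matrix ι ι ℂ) : traceNorm (c • A) = c * traceNorm A := by
  have hA := Matrix.posSemidef_conjTranspose_mul_self A
  have h : CFC.sqrt ((c • A).conjTranspose * (c • A)) = c • CFC.sqrt (A.conjTranspose * A) := by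
    refine CFC.sqrt_unique ?_ ((posSemidef_sqrt _).smul hc).nonneg
    rw [Matrix.conjTranspose_smul, star_trivial, Matrix.smul_mul, Matrix.mul_smul,
      Matrix.smul_mul, Matrix.mul_smul, sqrt_mul_sqrt hA]
  rw [traceNorm, h, Matrix.trace_smul, Complex.smul_re, smul_eq_mul, traceNorm]

lemma sum_sqrt_le {κ : Type*} [Fintype κ] {w : κ → ℝ} (hw : ∀ i, 0 ≤ w i) (hw1 : ∑ i, w i = 1)
    {K : ℝ} (hK : (Fintype.card κ : ℝ) ≤ K) : ∑ i, √(w i) ≤ √K := by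
  refine Real.le_sqrt_of_sq_le ?_
  have h := sq_sum_le_card_mul_sum_sq (s := Finset.univ) (f := fun i => √(w i))
  simp only [Real.sq_sqrt (hw _), hw1, mul_one, Finset.card_univ] at h
  exact h.trans hK

lemma smul_sqrt_sq {ι : Type*} [Fintype ι] [DecidableEq ι] {c : ℝ} (hc : 0 ≤ c)
    {A : Matrix ι ι ℂ} (hA : A.PosSemidef) :
    (√c • CFC.sqrt A).conjTranspose * (√c • CFC.sqrt A) = c • A := by
  rw [Matrix.conjTranspose_smul, star_trivial, (posSemidef_sqrt A).1.eq, Matrix.smul_mul,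
    Matrix.mul_smul, sqrt_mul_sqrt hA, smul_smul, Real.mul_self_sqrt hc]

/-- Two mixtures of states with pairwise fidelities at most `F` can be told apart with error at most
`√(p (1 - p))` times `F` times the number of terms. -/
lemma exists_isTest_errorProb_mixture_le {ι κ κ' : Type*} [Fintype ι] [DecidableEq ι] [Fintype κ]
    [Fintype κ'] {p : ℝ} (hp0 : 0 ≤ p) (hp1 : p ≤ 1) {ρ : κ → Matrix ι ι ℂ} {τ : κ' → Matrix ι ι ℂ}
    (hρ : ∀ i, (ρ i).PosSemidef) (hτ : ∀ j, (τ j).PosSemidef) {v : κ → ℝ} {w : κ' → ℝ}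
    (hv : ∀ i, 0 ≤ v i) (hv1 : ∑ i, v i = 1) (hw : ∀ j, 0 ≤ w j) (hw1 : ∑ j, w j = 1)
    {K F : ℝ} (hF0 : 0 ≤ F) (hκ : (Fintype.card κ : ℝ) ≤ K) (hκ' : (Fintype.card κ' : ℝ) ≤ K)
    (hF : ∀ i j, fidelity (ρ i) (τ j) ≤ F) :
    ∃ T, IsTest T ∧
      errorProb T p (∑ i, v i • ρ i) (∑ j, w j • τ j) ≤ √(p * (1 - p)) * K * F := by
  have hq : 0 ≤ 1 - p := sub_nonneg.mpr hp1
  have hK : 0 ≤ K := (Nat.cast_nonneg _).trans hκ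
  set X : κ → Matrix ι ι ℂ := fun i => √(p * v i) • CFC.sqrt (ρ i)
  set Y : κ' → Matrix ι ι ℂ := fun j => √((1 - p) * w j) • CFC.sqrt (τ j)
  have hX : ∑ i, (X i).conjTranspose * X i = p • ∑ i, v i • ρ i := by
    simp only [X, Finset.smul_sum, smul_smul]
    exact Finset.sum_congr rfl fun i _ => smul_sqrt_sq (mul_nonneg hp0 (hv i)) (hρ i)
  have hY : ∑ j, (Y j).conjTranspose * Y j = (1 - p) • ∑ j, w j • τ j := by
    simp only [Y, Finset.smul_sum, smul_smul]
    exact Finset.sum_congr rfl fun j _ => smul_sqrt_sq (mul_nonneg hq (hw j)) (hτ j)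
  have hXp : (∑ i, (X i).conjTranspose * X i).PosSemidef :=
    Matrix.posSemidef_sum _ fun i _ => Matrix.posSemidef_conjTranspose_mul_self (X i)
  have hYp : (∑ j, (Y j).conjTranspose * Y j).PosSemidef :=
    Matrix.posSemidef_sum _ fun j _ => Matrix.posSemidef_conjTranspose_mul_self (Y j)
  obtain ⟨T, hT, hle⟩ := exists_isTest_le_trace_mul
    (posSemidef_sqrt (∑ i, (X i).conjTranspose * X i))
    (posSemidef_sqrt (∑ j, (Y j).conjTranspose * Y j))
  refine ⟨T, hT, ?_⟩
  have h := hle.trans (re_trace_sqrt_mul_sqrt_le X Y)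
  rw [sqrt_mul_sqrt hXp, sqrt_mul_sqrt hYp, hX, hY, Matrix.mul_smul, Matrix.mul_smul,
    Matrix.trace_smul, Matrix.trace_smul, Complex.smul_re, Complex.smul_re, smul_eq_mul,
    smul_eq_mul] at h
  refine h.trans ?_
  have hterm : ∀ i j, traceNorm (X i * (Y j).conjTranspose) ≤
      √(p * (1 - p)) * F * (√(v i) * √(w j)) := by
    intro i j
    have e : X i * (Y j).conjTranspose =
        (√(p * v i) * √((1 - p) * w j)) • (CFC.sqrt (ρ i) * CFC.sqrt (τ j)) := by
      simp only [X, Y]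
      rw [Matrix.conjTranspose_smul, star_trivial, (posSemidef_sqrt (τ j)).1.eq, Matrix.smul_mul,
        Matrix.mul_smul, smul_smul]
    rw [e, traceNorm_smul (by positivity), Real.sqrt_mul hp0, Real.sqrt_mul hq, Real.sqrt_mul hp0]
    have h1 := mul_le_mul_of_nonneg_left (hF i j)
      (by positivity : 0 ≤ √p * √(v i) * (√(1 - p) * √(w j)))
    rw [fidelity] at h1
    linarith
  calc _ ≤ ∑ i, ∑ j, √(p * (1 - p)) * F * (√(v i) * √(w j)) :=
        Finset.sum_le_sum fun i _ => Finset.sum_le_sum fun j _ => hterm i j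
    _ = √(p * (1 - p)) * F * ((∑ i, √(v i)) * ∑ j, √(w j)) := by
        rw [Finset.sum_mul_sum]; simp only [Finset.mul_sum]
    -- Cauchy–Schwarz on each weight vector costs `√K` per side, hence a single factor `K` overall.
    _ ≤ √(p * (1 - p)) * F * (√K * √K) := by
        refine mul_le_mul_of_nonneg_left (mul_le_mul (sum_sqrt_le hv hv1 hκ)
          (sum_sqrt_le hw hw1 hκ') (Finset.sum_nonneg fun j _ => Real.sqrt_nonneg _)
          (Real.sqrt_nonneg _)) (by positivity)
    _ = √(p * (1 - p)) * K * F := by rw [Real.mul_self_sqrt hK]; ring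

variable {d n : ℕ} {p : ℝ} {T : Matrix (Fin n → Fin d) (Fin n → Fin d) ℂ}
  {D₁ D₂ : Set (Matrix (Fin d) (Fin d) ℂ)}

lemma compositeErrorProb_nonneg (hp0 : 0 ≤ p) (hp1 : p ≤ 1) (h₁ : ∀ ρ ∈ D₁, IsState ρ)
    (h₂ : ∀ ρ ∈ D₂, IsState ρ) (hT : IsTest T) : 0 ≤ compositeErrorProb n T p D₁ D₂ := by
  refine Real.sSup_nonneg ?_
  rintro _ ⟨ρ₁, m₁, ρ₂, m₂, rfl⟩
  exact errorProb_nonneg hp0 hp1 hT ((h₁ _ m₁).tensorPow n) ((h₂ _ m₂).tensorPow n)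

lemma errorProb_le_compositeErrorProb (hp0 : 0 ≤ p) (hp1 : p ≤ 1) (h₁ : ∀ ρ ∈ D₁, IsState ρ)
    (h₂ : ∀ ρ ∈ D₂, IsState ρ) (hT : IsTest T) {ρ₁ ρ₂ : Matrix (Fin d) (Fin d) ℂ} (m₁ : ρ₁ ∈ D₁)
    (m₂ : ρ₂ ∈ D₂) :
    errorProb T p (tensorPow ρ₁ n) (tensorPow ρ₂ n) ≤ compositeErrorProb n T p D₁ D₂ := by
  refine le_csSup ⟨1, ?_⟩ ⟨ρ₁, m₁, ρ₂, m₂, rfl⟩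
  rintro _ ⟨ρ₁, m₁, ρ₂, m₂, rfl⟩
  exact errorProb_le_one hp0 hp1 hT ((h₁ _ m₁).tensorPow n) ((h₂ _ m₂).tensorPow n)

lemma fidelity_le_maxFidelity (h₁ : ∀ ρ ∈ D₁, IsState ρ) (h₂ : ∀ ρ ∈ D₂, IsState ρ)
    {ρ₁ ρ₂ : Matrix (Fin d) (Fin d) ℂ} (m₁ : ρ₁ ∈ D₁) (m₂ : ρ₂ ∈ D₂) :
    fidelity ρ₁ ρ₂ ≤ maxFidelity D₁ D₂ := by
  refine le_csSup ⟨1, ?_⟩ ⟨ρ₁, m₁, ρ₂, m₂, rfl⟩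
  rintro _ ⟨ρ₁, m₁, ρ₂, m₂, rfl⟩
  exact fidelity_le_one (h₁ _ m₁) (h₂ _ m₂)

/-- The lower bound on the min-max error probability in terms of the fidelity of a pair. -/
lemma mul_fidelity_pow_le_minErrorProb (hp0 : 0 < p) (hp1 : p < 1) (h₁ : ∀ ρ ∈ D₁, IsState ρ)
    (h₂ : ∀ ρ ∈ D₂, IsState ρ) {ρ₁ ρ₂ : Matrix (Fin d) (Fin d) ℂ} (m₁ : ρ₁ ∈ D₁) (m₂ : ρ₂ ∈ D₂)
    (n : ℕ) : p * (1 - p) * (fidelity ρ₁ ρ₂ ^ n) ^ 2 ≤ minErrorProb n p D₁ D₂ := by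
  refine le_csInf ⟨_, 0, isTest_zero, rfl⟩ ?_
  rintro _ ⟨T, hT, rfl⟩
  refine le_trans ?_ (errorProb_le_compositeErrorProb hp0.le hp1.le h₁ h₂ hT m₁ m₂)
  rw [← fidelity_tensorPow (h₁ _ m₁).1 (h₂ _ m₂).1]
  exact mul_fidelity_sq_le_errorProb hp0 hp1 hT ((h₁ _ m₁).tensorPow n) ((h₂ _ m₂).tensorPow n)

/-- The upper bound on the min-max error probability of composite qubit hypotheses. -/
lemma minErrorProb_le {D₁ D₂ : Set (Matrix (Fin 2) (Fin 2) ℂ)} (hp0 : 0 < p) (hp1 : p < 1)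
    (h₁ : ∀ ρ ∈ D₁, IsState ρ) (h₂ : ∀ ρ ∈ D₂, IsState ρ) (hne₁ : D₁.Nonempty)
    (hne₂ : D₂.Nonempty) (n : ℕ) :
    minErrorProb n p D₁ D₂ ≤
      √(p * (1 - p)) * (n + 3).choose 3 * maxFidelity D₁ D₂ ^ n := by
  obtain ⟨r₁, k₁⟩ := hne₁
  obtain ⟨r₂, k₂⟩ := hne₂
  have hF0 : 0 ≤ maxFidelity D₁ D₂ :=
    (fidelity_nonneg _ _).trans (fidelity_le_maxFidelity h₁ h₂ k₁ k₂)
  obtain ⟨T, hT, hle⟩ := exists_isTest_forall_errorProb_le (S₁ := (fun ρ => tensorPow ρ n) '' D₁)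
    (S₂ := (fun ρ => tensorPow ρ n) '' D₂) p
    (√(p * (1 - p)) * (n + 3).choose 3 * maxFidelity D₁ D₂ ^ n) (by
      intro σ₁ hσ₁ σ₂ hσ₂
      obtain ⟨κ₁, _, ρ, v, hρ, hv, hv1, rfl, hc₁⟩ := exists_mixture_of_mem_convexHull h₁ hσ₁
      obtain ⟨κ₂, _, τ, w, hτ, hw, hw1, rfl, hc₂⟩ := exists_mixture_of_mem_convexHull h₂ hσ₂
      refine exists_isTest_errorProb_mixture_le hp0.le hp1.le
        (fun i => posSemidef_tensorPow (h₁ _ (hρ i)).1 n)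
        (fun j => posSemidef_tensorPow (h₂ _ (hτ j)).1 n) hv hv1 hw hw1 (pow_nonneg hF0 n)
        (Nat.cast_le.mpr hc₁) (Nat.cast_le.mpr hc₂) fun i j => ?_
      rw [fidelity_tensorPow (h₁ _ (hρ i)).1 (h₂ _ (hτ j)).1]
      exact pow_le_pow_left₀ (fidelity_nonneg _ _)
        (fidelity_le_maxFidelity h₁ h₂ (hρ i) (hτ j)) n)
  refine le_trans (csInf_le ⟨0, ?_⟩ ⟨T, hT, rfl⟩) (csSup_le ⟨_, r₁, k₁, r₂, k₂, rfl⟩ ?_)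
  · rintro _ ⟨U, hU, rfl⟩
    exact compositeErrorProb_nonneg hp0.le hp1.le h₁ h₂ hU
  · rintro _ ⟨ρ₁, m₁, ρ₂, m₂, rfl⟩
    exact hle _ ⟨ρ₁, m₁, rfl⟩ _ ⟨ρ₂, m₂, rfl⟩

end CompositeError

/-! ### From error bounds to sample complexity -/

section SampleComplexity

/-- Bound the binomial by `(n+3)³/6` and cube `x ≤ exp (x - 1)` at `x = a (n+3) / 3`. -/
lemma choose_three_le_exp {a : ℝ} (ha : 0 < a) (n : ℕ) :
    ((n + 3).choose 3 : ℝ) ≤ 9 * Real.exp (3 * (a - 1)) / (2 * a ^ 3) * Real.exp (a * n) := by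
  have h1 : ((n + 3).choose 3 : ℝ) ≤ ((n + 3 : ℕ) : ℝ) ^ 3 / (Nat.factorial 3 : ℕ) :=
    Nat.choose_le_pow_div 3 (n + 3)
  have h2 : a * (n + 3) / 3 ≤ Real.exp (a * (n + 3) / 3 - 1) := by
    simpa using Real.add_one_le_exp (a * (n + 3) / 3 - 1)
  have h3 := pow_le_pow_left₀ (by positivity) h2 3
  have h4 : Real.exp (a * (n + 3) / 3 - 1) ^ 3 = Real.exp (3 * (a - 1)) * Real.exp (a * n) := by
    rw [← Real.exp_nat_mul, ← Real.exp_add]; congr 1; push_cast; ring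
  rw [h4] at h3
  refine h1.trans ?_
  rw [div_mul_eq_mul_div, le_div_iff₀ (by positivity)]
  have h5 : (Nat.factorial 3 : ℝ) = 6 := by norm_num [Nat.factorial]
  rw [h5]; push_cast
  calc ((n : ℝ) + 3) ^ 3 / 6 * (2 * a ^ 3) = 9 * (a * (n + 3) / 3) ^ 3 := by ring
    _ ≤ 9 * (Real.exp (3 * (a - 1)) * Real.exp (a * n)) := by linarith
    _ = _ := by ring

lemma one_le_nine_mul_exp_div {a : ℝ} (ha : 0 < a) :
    1 ≤ 9 * Real.exp (3 * (a - 1)) / (2 * a ^ 3) := by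
  rw [one_le_div (by positivity)]
  have h := pow_le_pow_left₀ ha.le (by simpa using Real.add_one_le_exp (a - 1)) 3
  rw [← Real.exp_nat_mul] at h
  push_cast at h
  nlinarith [pow_pos ha 3]

lemma exists_sampleComplexity_eq {d : ℕ} {p δ : ℝ} {D₁ D₂ : Set (Matrix (Fin d) (Fin d) ℂ)} {n : ℕ}
    (hn : 1 ≤ n) (h : minErrorProb n p D₁ D₂ ≤ δ) :
    ∃ N : ℕ, sampleComplexity p D₁ D₂ δ = N ∧ 1 ≤ N ∧ minErrorProb N p D₁ D₂ ≤ δ ∧ N ≤ n := by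
  classical
  have hex : ∃ n, 1 ≤ n ∧ minErrorProb n p D₁ D₂ ≤ δ := ⟨n, hn, h⟩
  refine ⟨Nat.find hex, le_antisymm (iInf₂_le (Nat.find hex) (Nat.find_spec hex)) ?_, (Nat.find_spec hex).1,
    (Nat.find_spec hex).2, Nat.find_min' hex ⟨hn, h⟩⟩
  exact le_iInf₂ fun m hm => Nat.cast_le.mpr (Nat.find_min' hex hm)

/-- The function of `a` whose infimum bounds the sample complexity. -/
noncomputable def complexityBound (p δ F a : ℝ) : ℝ :=
  (Real.log (√(p * (1 - p)) / δ) + Real.log (9 * Real.exp (3 * (a - 1)) / (2 * a ^ 3))) /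
    (-Real.log F - a)

variable {p δ : ℝ} {D₁ D₂ : Set (Matrix (Fin 2) (Fin 2) ℂ)}

/-- Non-orthogonality enters here: it keeps `log F_max` away from the default value `log 0 = 0`. -/
lemma IsConstrainedPair.maxFidelity_pos (h : IsConstrainedPair D₁ D₂) :
    0 < maxFidelity D₁ D₂ := by
  obtain ⟨ρ₁, m₁, ρ₂, m₂, hne⟩ := h.not_orthogonal
  refine lt_of_lt_of_le ((fidelity_nonneg ρ₁ ρ₂).lt_of_ne fun h0 => hne ?_)
    (fidelity_le_maxFidelity h.isState_left h.isState_right m₁ m₂)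
  exact mul_eq_zero_of_fidelity_eq_zero (h.isState_left _ m₁).1 (h.isState_right _ m₂).1 h0.symm

lemma log_five_halves_pos : 0 < Real.log (5 / 2) := Real.log_pos (by norm_num)

lemma IsConstrainedPair.le_neg_log (h : IsConstrainedPair D₁ D₂) :
    Real.log (5 / 2) ≤ -Real.log (maxFidelity D₁ D₂) := by
  rw [← Real.log_inv]
  refine Real.log_le_log (by norm_num) ?_
  rw [le_inv_comm₀ (by norm_num) h.maxFidelity_pos]
  exact h.maxFidelity_le.trans (by norm_num)

lemma lt_sqrt_mul_one_sub (hp0 : 0 < p) (hδ0 : 0 < δ) (hδ : δ < min p (1 - p)) :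
    δ < √(p * (1 - p)) := by
  obtain ⟨h1, h2⟩ := lt_min_iff.mp hδ
  refine Real.lt_sqrt_of_sq_lt ?_
  nlinarith

/-- The slack `ε` is needed because the infimum over the open interval of `a` need not be attained.
-/
lemma minErrorProb_le_mul_exp (hp0 : 0 < p) (hp1 : p < 1) (hD : IsConstrainedPair D₁ D₂)
    (hδ0 : 0 < δ) {a ε : ℝ} (ha : a ∈ Set.Ioo 0 (Real.log (5 / 2))) (hε : 0 ≤ ε) {n : ℕ}
    (hn : complexityBound p δ (maxFidelity D₁ D₂) a ≤ n + ε) :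
    minErrorProb n p D₁ D₂ ≤ δ * Real.exp (-Real.log (maxFidelity D₁ D₂) * ε) := by
  obtain ⟨ρ₁, m₁, ρ₂, m₂, -⟩ := hD.not_orthogonal
  have hF := hD.maxFidelity_pos
  have hL := hD.le_neg_log
  set F := maxFidelity D₁ D₂
  have hden : 0 < -Real.log F - a := by linarith [ha.2]
  have hs : 0 < √(p * (1 - p)) := Real.sqrt_pos.mpr (mul_pos hp0 (sub_pos.mpr hp1))
  have hK := one_le_nine_mul_exp_div ha.1
  rw [complexityBound, div_le_iff₀ hden] at hn
  refine (minErrorProb_le hp0 hp1 hD.isState_left hD.isState_right ⟨_, m₁⟩ ⟨_, m₂⟩ n).trans ?_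
  calc √(p * (1 - p)) * (n + 3).choose 3 * F ^ n
      ≤ √(p * (1 - p)) * (9 * Real.exp (3 * (a - 1)) / (2 * a ^ 3) * Real.exp (a * n)) * F ^ n := by
        gcongr; exact choose_three_le_exp ha.1 n
    _ = δ * Real.exp (Real.log (√(p * (1 - p)) / δ) +
          Real.log (9 * Real.exp (3 * (a - 1)) / (2 * a ^ 3)) + (a * n + n * Real.log F)) := by
        rw [Real.exp_add, Real.exp_add, Real.exp_add, Real.exp_log (by positivity),
          Real.exp_log (by positivity), Real.exp_nat_mul, Real.exp_log hF]
        field_simp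
    _ ≤ _ := by
        gcongr
        nlinarith [mul_nonneg ha.1.le hε]

lemma exists_isGLB_complexityBound (hp0 : 0 < p) (hD : IsConstrainedPair D₁ D₂)
    (hδ0 : 0 < δ) (hδ : δ < min p (1 - p)) :
    ∃ B, 0 < B ∧ IsGLB (complexityBound p δ (maxFidelity D₁ D₂) ''
      Set.Ioo 0 (Real.log (5 / 2))) B := by
  have hL := hD.le_neg_log
  have hl := log_five_halves_pos
  set F := maxFidelity D₁ D₂
  have hnum : 0 < Real.log (√(p * (1 - p)) / δ) :=
    Real.log_pos ((one_lt_div hδ0).mpr (lt_sqrt_mul_one_sub hp0 hδ0 hδ))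
  have hlow : Real.log (√(p * (1 - p)) / δ) / -Real.log F ∈
      lowerBounds (complexityBound p δ F '' Set.Ioo 0 (Real.log (5 / 2))) := by
    rintro _ ⟨a, ha, rfl⟩
    have hK := Real.log_nonneg (one_le_nine_mul_exp_div ha.1)
    exact div_le_div₀ (by linarith) (by linarith) (by linarith [ha.2]) (by linarith [ha.1])
  have hne : (complexityBound p δ F '' Set.Ioo 0 (Real.log (5 / 2))).Nonempty :=
    (Set.nonempty_Ioo.mpr hl).image _
  refine ⟨_, lt_of_lt_of_le (div_pos hnum (by linarith)) (le_csInf hne hlow),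
    isGLB_csInf hne ⟨_, hlow⟩⟩

/-- The explicit upper bound on the sample complexity. -/
lemma exists_sampleComplexity_le (hp0 : 0 < p) (hp1 : p < 1) (hD : IsConstrainedPair D₁ D₂)
    (hδ0 : 0 < δ) (hδ : δ < min p (1 - p)) :
    ∃ N : ℕ, sampleComplexity p D₁ D₂ δ = N ∧ 1 ≤ N ∧ minErrorProb N p D₁ D₂ ≤ δ ∧
      ∃ B, IsGLB (complexityBound p δ (maxFidelity D₁ D₂) '' Set.Ioo 0 (Real.log (5 / 2))) B ∧
        (N : ℤ) ≤ ⌈B⌉ := by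
  obtain ⟨B, hB0, hB⟩ := exists_isGLB_complexityBound hp0 hD hδ0 hδ
  have hL : 0 < -Real.log (maxFidelity D₁ D₂) := log_five_halves_pos.trans_le hD.le_neg_log
  have hn : minErrorProb ⌈B⌉₊ p D₁ D₂ ≤ δ := by
    -- For each `ε > 0` some `a` has bound below `B + ε`; letting `ε → 0` gives exactly `δ` at
    -- `⌈B⌉₊` copies.
    refine ge_of_tendsto (x := nhdsWithin (0 : ℝ) (Set.Ioi 0))
      (f := fun ε => δ * Real.exp (-Real.log (maxFidelity D₁ D₂) * ε)) ?_ ?_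
    · refine tendsto_nhdsWithin_of_tendsto_nhds ?_
      have hc : Continuous fun ε : ℝ => δ * Real.exp (-Real.log (maxFidelity D₁ D₂) * ε) := by
        fun_prop
      simpa using hc.tendsto 0
    · filter_upwards [self_mem_nhdsWithin] with ε hε
      obtain ⟨_, ⟨a, ha, rfl⟩, -, hlt⟩ := hB.exists_between (lt_add_of_pos_right B hε)
      exact minErrorProb_le_mul_exp hp0 hp1 hD hδ0 ha (le_of_lt hε)
        (hlt.le.trans (add_le_add_left (Nat.le_ceil B) ε))
  obtain ⟨N, hN, hN1, hNδ, hle⟩ := exists_sampleComplexity_eq (Nat.one_le_ceil_iff.mpr hB0) hn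
  refine ⟨N, hN, hN1, hNδ, B, hB, ?_⟩
  rw [← Int.natCast_ceil_eq_ceil hB0.le]
  exact_mod_cast hle

/-- The pairwise lower bound passes to the supremum after taking `2N`-th roots, which requires `N ≥
1`. -/
lemma mul_maxFidelity_pow_le_minErrorProb (hp0 : 0 < p) (hp1 : p < 1)
    (hD : IsConstrainedPair D₁ D₂) {N : ℕ} (hN : 1 ≤ N) :
    p * (1 - p) * maxFidelity D₁ D₂ ^ (2 * N) ≤ minErrorProb N p D₁ D₂ := by
  obtain ⟨ρ₁, m₁, ρ₂, m₂, -⟩ := hD.not_orthogonal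
  have hpq : 0 < p * (1 - p) := mul_pos hp0 (sub_pos.mpr hp1)
  have hN0 : 2 * N ≠ 0 := by omega
  have h : ∀ ρ₁ ∈ D₁, ∀ ρ₂ ∈ D₂,
      fidelity ρ₁ ρ₂ ^ (2 * N) ≤ minErrorProb N p D₁ D₂ / (p * (1 - p)) := by
    intro ρ₁ m₁ ρ₂ m₂
    rw [le_div_iff₀' hpq, mul_comm 2 N, pow_mul]
    exact mul_fidelity_pow_le_minErrorProb hp0 hp1 hD.isState_left hD.isState_right m₁ m₂ N
  have hQ : 0 ≤ minErrorProb N p D₁ D₂ / (p * (1 - p)) :=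
    (pow_nonneg (fidelity_nonneg ρ₁ ρ₂) _).trans (h _ m₁ _ m₂)
  rw [← le_div_iff₀' hpq, ← Real.rpow_inv_natCast_pow hQ hN0]
  refine pow_le_pow_left₀ hD.maxFidelity_pos.le (csSup_le ⟨_, ρ₁, m₁, ρ₂, m₂, rfl⟩ ?_) _
  rintro _ ⟨τ₁, k₁, τ₂, k₂, rfl⟩
  refine le_of_pow_le_pow_left₀ hN0 (Real.rpow_nonneg hQ _) ?_
  rw [Real.rpow_inv_natCast_pow hQ hN0]
  exact h _ k₁ _ k₂

lemma log_inv_le_mul (hp0 : 0 < p) (hp1 : p < 1) (hD : IsConstrainedPair D₁ D₂)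
    {N : ℕ} (hN : 1 ≤ N) (hNδ : minErrorProb N p D₁ D₂ ≤ δ) :
    Real.log (1 / δ) ≤ 2 * N * -Real.log (maxFidelity D₁ D₂) - Real.log (p * (1 - p)) := by
  have hF := hD.maxFidelity_pos
  have hpq : 0 < p * (1 - p) := mul_pos hp0 (sub_pos.mpr hp1)
  have h := Real.log_le_log (by positivity)
    ((mul_maxFidelity_pow_le_minErrorProb hp0 hp1 hD hN).trans hNδ)
  rw [Real.log_mul hpq.ne' (by positivity), Real.log_pow] at h
  push_cast at h
  rw [one_div, Real.log_inv]
  linarith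

/-- Evaluate at the midpoint `a = log (5/2) / 2`: then `a ≤ L / 2`, so the denominator `L - a` is at
least `L / 2`. -/
lemma le_of_isGLB_complexityBound (hp0 : 0 < p) (hp1 : p < 1) (hD : IsConstrainedPair D₁ D₂)
    (hδ0 : 0 < δ) (hδ1 : δ < 1) {B : ℝ}
    (hB : IsGLB (complexityBound p δ (maxFidelity D₁ D₂) '' Set.Ioo 0 (Real.log (5 / 2))) B) {k : ℝ}
    (hk : k = Real.log (9 * Real.exp (3 * (Real.log (5 / 2) / 2 - 1)) /
      (2 * (Real.log (5 / 2) / 2) ^ 3))) :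
    B ≤ 2 * (Real.log (1 / δ) / -Real.log (maxFidelity D₁ D₂)) + 2 * k / Real.log (5 / 2) := by
  have hl := log_five_halves_pos
  have hL := hD.le_neg_log
  have h := hB.1 ⟨Real.log (5 / 2) / 2, ⟨by linarith, by linarith⟩, rfl⟩
  rw [complexityBound, ← hk] at h
  set L := -Real.log (maxFidelity D₁ D₂)
  have hk0 : 0 ≤ k := hk ▸ Real.log_nonneg (one_le_nine_mul_exp_div (by positivity))
  have hs : 0 < √(p * (1 - p)) := Real.sqrt_pos.mpr (mul_pos hp0 (sub_pos.mpr hp1))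
  have hs1 : √(p * (1 - p)) ≤ 1 := Real.sqrt_le_one.mpr (by nlinarith)
  have h1 : Real.log (√(p * (1 - p)) / δ) ≤ Real.log (1 / δ) :=
    Real.log_le_log (by positivity) (by gcongr)
  have hℓ : 0 ≤ Real.log (1 / δ) := Real.log_nonneg (by rw [one_le_div hδ0]; exact hδ1.le)
  have hL0 : 0 < L := hl.trans_le hL
  calc B ≤ _ := h
    _ ≤ (Real.log (1 / δ) + k) / (L / 2) :=
        div_le_div₀ (by positivity) (by linarith) (by positivity) (by linarith)
    _ = 2 * (Real.log (1 / δ) / L) + 2 * k / L := by field_simp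
    _ ≤ _ := by gcongr

end SampleComplexity

end CompositeQHT

/-! ### The main theorem -/

theorem mainTheorem4 (p : ℝ) (hp0 : 0 < p) (hp1 : p < 1) :
    -- the explicit upper bound on the sample complexity
    (∀ D₁ D₂ : Set (Matrix (Fin 2) (Fin 2) ℂ), CompositeQHT.IsConstrainedPair D₁ D₂ →
      ∀ δ : ℝ, 0 < δ → δ < min p (1 - p) →
        ∃ N : ℕ, CompositeQHT.sampleComplexity p D₁ D₂ δ = (N : ℕ∞) ∧
          ∃ B : ℝ,
            IsGLB
              ((fun a : ℝ =>
                (Real.log (Real.sqrt (p * (1 - p)) / δ)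
                    + Real.log (9 * Real.exp (3 * (a - 1)) / (2 * a ^ 3)))
                  / (-Real.log (CompositeQHT.maxFidelity D₁ D₂) - a)) ''
                Set.Ioo 0 (Real.log (5 / 2))) B ∧
            (N : ℤ) ≤ ⌈B⌉) ∧
    -- the scaling of the sample complexity, with constants that depend on `p` only
    (∃ c : ℝ, 0 < c ∧ ∃ C : ℝ, 0 < C ∧
      ∀ D₁ D₂ : Set (Matrix (Fin 2) (Fin 2) ℂ), CompositeQHT.IsConstrainedPair D₁ D₂ →
        ∀ δ : ℝ, 0 < δ → δ < min p (1 - p) →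
          ∃ N : ℕ, CompositeQHT.sampleComplexity p D₁ D₂ δ = (N : ℕ∞) ∧
            c * (Real.log (1 / δ) / (-Real.log (CompositeQHT.maxFidelity D₁ D₂))) ≤ (N : ℝ) ∧
            (N : ℝ) ≤
              C * max 1 (Real.log (1 / δ) / (-Real.log (CompositeQHT.maxFidelity D₁ D₂))) ∧
            (δ ≤ CompositeQHT.maxFidelity D₁ D₂ →
              (N : ℝ) ≤
                C * (Real.log (1 / δ) / (-Real.log (CompositeQHT.maxFidelity D₁ D₂))))) := by
  constructor
  · intro D₁ D₂ hD δ hδ0 hδ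
    obtain ⟨N, hN, -, -, B, hB, hle⟩ :=
      CompositeQHT.exists_sampleComplexity_le hp0 hp1 hD hδ0 hδ
    exact ⟨N, hN, B, hB, hle⟩
  · have hl := CompositeQHT.log_five_halves_pos
    have hpq : 0 < p * (1 - p) := mul_pos hp0 (sub_pos.mpr hp1)
    have hm : 0 ≤ -Real.log (p * (1 - p)) :=
      neg_nonneg.mpr (Real.log_nonpos hpq.le (by nlinarith))
    obtain ⟨k, hk⟩ : ∃ k, k = Real.log (9 * Real.exp (3 * (Real.log (5 / 2) / 2 - 1)) /
      (2 * (Real.log (5 / 2) / 2) ^ 3)) := ⟨_, rfl⟩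
    have hk0 : 0 ≤ k :=
      hk ▸ Real.log_nonneg (CompositeQHT.one_le_nine_mul_exp_div (by positivity))
    -- In `C`, the `3` is the leading factor `2` plus `1` for the ceiling. In `c`, the additive
    -- `-log (p (1 - p))` is absorbed using `N * -log F_max ≥ log (5/2)`.
    refine ⟨(2 + -Real.log (p * (1 - p)) / Real.log (5 / 2))⁻¹, by positivity,
      3 + 2 * k / Real.log (5 / 2), by positivity, ?_⟩
    intro D₁ D₂ hD δ hδ0 hδ
    obtain ⟨N, hN, hN1, hNδ, B, hB, hle⟩ :=
      CompositeQHT.exists_sampleComplexity_le hp0 hp1 hD hδ0 hδ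
    have hδ1 : δ < 1 := (hδ.trans_le (min_le_left _ _)).trans hp1
    have hL := hD.le_neg_log
    have hlow := CompositeQHT.log_inv_le_mul hp0 hp1 hD hN1 hNδ
    have hup := CompositeQHT.le_of_isGLB_complexityBound hp0 hp1 hD hδ0 hδ1 hB hk
    have hNB : (N : ℝ) ≤ B + 1 := by
      have h : (N : ℝ) ≤ (⌈B⌉ : ℤ) := by exact_mod_cast hle
      exact h.trans (Int.ceil_lt_add_one B).le
    have hN1' : (1 : ℝ) ≤ N := by exact_mod_cast hN1
    have hbound : (N : ℝ) ≤ (3 + 2 * k / Real.log (5 / 2)) *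
        max 1 (Real.log (1 / δ) / (-Real.log (CompositeQHT.maxFidelity D₁ D₂))) := by
      have h1 := le_max_left 1 (Real.log (1 / δ) / (-Real.log (CompositeQHT.maxFidelity D₁ D₂)))
      have h2 := le_max_right 1 (Real.log (1 / δ) / (-Real.log (CompositeQHT.maxFidelity D₁ D₂)))
      have h3 := mul_le_mul_of_nonneg_left h1 (by positivity : 0 ≤ 2 * k / Real.log (5 / 2))
      linarith
    refine ⟨N, hN, ?_, hbound, fun hF => ?_⟩
    · rw [inv_mul_le_iff₀ (by positivity), div_le_iff₀ (hl.trans_le hL)]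
      have h1 : -Real.log (p * (1 - p)) ≤ -Real.log (p * (1 - p)) / Real.log (5 / 2) *
          (N * -Real.log (CompositeQHT.maxFidelity D₁ D₂)) := by
        rw [div_mul_eq_mul_div, le_div_iff₀ hl]
        refine mul_le_mul_of_nonneg_left ?_ hm
        exact hL.trans (le_mul_of_one_le_left (hl.le.trans hL) hN1')
      linarith
    -- When `δ ≤ F_max` the ratio is at least `1`, so the maximum is the ratio itself.
    · have h1 : 1 ≤ Real.log (1 / δ) / (-Real.log (CompositeQHT.maxFidelity D₁ D₂)) := by
        rw [one_le_div (hl.trans_le hL), one_div, Real.log_inv]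
        exact neg_le_neg (Real.log_le_log hδ0 hF)
      rwa [max_eq_right h1] at hbound
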